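/- All Banach spaces are complex. An operator ideal $\mathcal U$ assigns to every pair of Banach spaces $E,F$ a linear subspace $\mathcal U(E,F)$ of the space $\mathcal L(E,F)$ of bounded linear operators which contains all operators of finite rank, in such a way that $RST\in\mathcal U(E_0,F_0)$ whenever $T\in\mathcal L(E_0,E)$, $S\in\mathcal U(E,F)$ and $R\in\mathcal L(F,F_0)$. It is closed if every $\mathcal U(E,F)$ is closed in $\mathcal L(E,F)$ for the operator norm, and surjective if, for all $T\in\mathcal L(E,F)$ and all surjective $q\in\mathcal L(G,E)$, $Tq\in\mathcal U(G,F)$ implies $T\in\mathcal U(E,F)$. Let $\mathcal C_{\mathcal U}(F)$ be the collection of all sets $A\subseteq F$ such that $A\subseteq T(B_Z)$ for some Banach space $Z$ with closed unit ball $B_Z$ and some $T\in\mathcal U(Z,F)$. For a nonempty closed, convex, balanced, bounded set $K\subseteq F$, let $F_K$ be the linear span of $K$, normed by the Minkowski functional of $K$. A mapping $f:E\to F$ is holomorphic if around every point of $E$ it is the sum of a power series of continuous homogeneous polynomials converging uniformly on some ball of positive radius. Theorem. Let $\mathcal U$ be a closed surjective operator ideal, let $E$ and $F$ be Banach spaces,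 and let $f:E\to F$ be holomorphic. The following assertions are equivalent: (a) every $x\in E$ has a neighbourhood $V_x$ with $f(V_x)\in\mathcal C_{\mathcal U}(F)$; (b) there is a nonempty closed, convex, balanced set $K\in\mathcal C_{\mathcal U}(F)$ (such a set is automatically bounded) such that $f$ takes its values in $F_K$ and is holomorphic as a mapping from $E$ into $F_K$; (c) there are a Banach space $G$, a holomorphic mapping $g:E\to G$ and an operator $T\in\mathcal U(G,F)$ such that $f=T\circ g$. -/

import Mathlib

open Set Topology Pointwise

universe u v

/-- An operator ideal on the class of complex Banach spaces: for all Banach spaces `E`, `F` a linear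
subspace `component E F` of the bounded operators from `E` to `F`, containing the operators of
finite rank and stable under composition on both sides with bounded operators. -/
structure OperatorIdeal where
  /-- the operators from `E` to `F` that belong to the ideal -/
  component : ∀ (E F : Type u) [NormedAddCommGroup E] [NormedSpace ℂ E] [CompleteSpace E]
    [NormedAddCommGroup F] [NormedSpace ℂ F] [CompleteSpace F], Submodule ℂ (E →L[ℂ] F)
  finiteRank_mem : ∀ {E F : Type u} [NormedAddCommGroup E] [NormedSpace ℂ E] [CompleteSpace E]
    [NormedAddCommGroup F] [NormedSpace ℂ F] [CompleteSpace F] (T : E →L[ℂ] F),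
    FiniteDimensional ℂ (LinearMap.range (T : E →ₗ[ℂ] F)) → T ∈ component E F
  comp_mem : ∀ {E₀ E F F₀ : Type u}
    [NormedAddCommGroup E₀] [NormedSpace ℂ E₀] [CompleteSpace E₀]
    [NormedAddCommGroup E] [NormedSpace ℂ E] [CompleteSpace E]
    [NormedAddCommGroup F] [NormedSpace ℂ F] [CompleteSpace F]
    [NormedAddCommGroup F₀] [NormedSpace ℂ F₀] [CompleteSpace F₀]
    (R : F →L[ℂ] F₀) (S : E →L[ℂ] F) (T : E₀ →L[ℂ] E),
    S ∈ component E F → (R.comp S).comp T ∈ component E₀ F₀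

namespace OperatorIdeal

/-- The ideal is closed: every component is closed for the operator norm. -/
def IsClosedIdeal (U : OperatorIdeal.{u}) : Prop :=
  ∀ (E F : Type u) [NormedAddCommGroup E] [NormedSpace ℂ E] [CompleteSpace E]
    [NormedAddCommGroup F] [NormedSpace ℂ F] [CompleteSpace F],
    IsClosed (U.component E F : Set (E →L[ℂ] F))

/-- The ideal is surjective: if `q : G → E` is a surjective operator and `T q` is in the ideal,
then so is `T`. -/
def IsSurjectiveIdeal (U : OperatorIdeal.{u}) : Prop :=
  ∀ (E F G : Type u) [NormedAddCommGroup E] [NormedSpace ℂ E] [CompleteSpace E]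
    [NormedAddCommGroup F] [NormedSpace ℂ F] [CompleteSpace F]
    [NormedAddCommGroup G] [NormedSpace ℂ G] [CompleteSpace G]
    (T : E →L[ℂ] F) (q : G →L[ℂ] E), Function.Surjective q →
    T.comp q ∈ U.component G F → T ∈ U.component E F

variable {F : Type u} [NormedAddCommGroup F] [NormedSpace ℂ F] [CompleteSpace F]

/-- The collection of all `A ⊆ F` contained in the image of the closed unit ball of some Banach
space `Z` under some operator `T : Z → F` of the ideal. -/
def BoundedSets (U : OperatorIdeal.{u}) (F : Type u) [NormedAddCommGroup F] [NormedSpace ℂ F]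
    [CompleteSpace F] : Set (Set F) :=
  {A | ∃ (Z : Type u) (_ : NormedAddCommGroup Z) (_ : NormedSpace ℂ Z) (_ : CompleteSpace Z)
    (T : Z →L[ℂ] F), T ∈ U.component Z F ∧ A ⊆ T '' Metric.closedBall (0 : Z) 1}

/-- Every point of the domain has a neighbourhood whose image is in `U.BoundedSets F`. -/
def LocallyBounded (U : OperatorIdeal.{u}) {E : Type v} [NormedAddCommGroup E] (f : E → F) : Prop :=
  ∀ x : E, ∃ V ∈ 𝓝 x, f '' V ∈ U.BoundedSets F

end OperatorIdeal

/-- `f` is a holomorphic mapping from `E` to `F`: near every point it is the sum of a power series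
of continuous homogeneous polynomials with positive radius of convergence. -/
def Holomorphic {E : Type u} {F : Type v} [NormedAddCommGroup E] [NormedSpace ℂ E]
    [NormedAddCommGroup F] [NormedSpace ℂ F] (f : E → F) : Prop :=
  ∀ x : E, AnalyticAt ℂ f x

/-- A (nonempty) closed, convex, balanced, bounded subset of a complex normed space. -/
structure BanachDisk (F : Type u) [NormedAddCommGroup F] [NormedSpace ℂ F] where
  carrier : Set F
  nonempty : carrier.Nonempty
  isClosed : IsClosed carrier
  convex : Convex ℝ carrier
  balanced : Balanced ℂ carrier
  isBounded : Bornology.IsBounded carrier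

namespace BanachDisk

variable {F : Type u} [NormedAddCommGroup F] [NormedSpace ℂ F] (K : BanachDisk F)

/-- The space `F_K`: the linear span of `K`, to be normed by the Minkowski functional of `K` (and
not by the norm of `F`). -/
def NormedSpan : Type u := Submodule.span ℂ K.carrier

instance : AddCommGroup K.NormedSpan := inferInstanceAs (AddCommGroup (Submodule.span ℂ K.carrier))

instance : Module ℂ K.NormedSpan := inferInstanceAs (Module ℂ (Submodule.span ℂ K.carrier))

/-- The natural inclusion of `F_K` into `F`. -/
def incl : K.NormedSpan →ₗ[ℂ] F := (Submodule.span ℂ K.carrier).subtype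

noncomputable instance : Norm K.NormedSpan := ⟨fun x => gauge K.carrier (K.incl x)⟩

theorem norm_def (x : K.NormedSpan) : ‖x‖ = gauge K.carrier (K.incl x) := rfl

theorem incl_injective : Function.Injective K.incl := Subtype.val_injective

theorem zero_mem : (0 : F) ∈ K.carrier := K.balanced.zero_mem K.nonempty

theorem exists_mem_smul (x : K.NormedSpan) : ∃ r : ℝ, 0 < r ∧ K.incl x ∈ r • K.carrier := by
  obtain ⟨x, hx⟩ := x
  change ∃ r : ℝ, 0 < r ∧ x ∈ r • K.carrier
  induction hx using Submodule.span_induction with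
  | mem x h => exact ⟨1, one_pos, by simpa using h⟩
  | zero => exact ⟨1, one_pos, by simpa using K.zero_mem⟩
  | add x y _ _ hx hy =>
    obtain ⟨a, ha, hxa⟩ := hx
    obtain ⟨b, hb, hyb⟩ := hy
    refine ⟨a + b, by positivity, ?_⟩
    rw [K.convex.add_smul ha.le hb.le]
    exact Set.add_mem_add hxa hyb
  | smul c x _ hx =>
    obtain ⟨a, ha, y, hy, rfl⟩ := hx
    have hp : (0 : ℝ) < ‖c‖ + 1 := by positivity
    refine ⟨(‖c‖ + 1) * a, by positivity, (((‖c‖ + 1 : ℝ) : ℂ)⁻¹ * c) • y, ?_, ?_⟩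
    · refine K.balanced.smul_mem ?_ hy
      rw [norm_mul, norm_inv, Complex.norm_real, Real.norm_of_nonneg hp.le, inv_mul_le_iff₀ hp]
      linarith
    · have hc : ((‖c‖ + 1 : ℝ) : ℂ) ≠ 0 := by exact_mod_cast hp.ne'
      simp only [← Complex.coe_smul, smul_smul]
      congr 1
      push_cast at hc ⊢
      field_simp

theorem exists_lt_mem_smul (x : K.NormedSpan) {a : ℝ} (h : ‖x‖ < a) :
    ∃ r : ℝ, 0 < r ∧ r < a ∧ K.incl x ∈ r • K.carrier := by
  obtain ⟨r, ⟨hr, hxr⟩, hra⟩ := exists_lt_of_csInf_lt (K.exists_mem_smul x) h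
  exact ⟨r, hr, hra, hxr⟩

theorem normCore : NormedSpace.Core ℂ K.NormedSpan where
  norm_nonneg x := gauge_nonneg _
  norm_smul c x := by
    rw [norm_def, norm_def, map_smul, gauge_smul K.balanced]
  norm_triangle x y := by
    refine le_of_forall_pos_lt_add fun ε hε => ?_
    obtain ⟨a, ha, ha', hxa⟩ :=
      K.exists_lt_mem_smul x (a := ‖x‖ + ε / 2) (by linarith)
    obtain ⟨b, hb, hb', hyb⟩ :=
      K.exists_lt_mem_smul y (a := ‖y‖ + ε / 2) (by linarith)
    have h : K.incl (x + y) ∈ (a + b) • K.carrier := by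
      rw [K.convex.add_smul ha.le hb.le, map_add]
      exact Set.add_mem_add hxa hyb
    have := gauge_le_of_mem (add_pos ha hb).le h
    rw [norm_def]
    linarith
  norm_eq_zero_iff x := by
    refine ⟨fun h => ?_, fun h => by rw [norm_def, h, map_zero, gauge_zero]⟩
    obtain ⟨M, hM, hKM⟩ := K.isBounded.exists_pos_norm_le
    refine K.incl_injective ?_
    rw [map_zero, ← norm_le_zero_iff]
    refine le_of_forall_pos_le_add fun ε hε => ?_
    obtain ⟨r, hr, hr', y, hy, hxy⟩ := K.exists_lt_mem_smul x (a := ε / M) (by rw [h]; positivity)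
    have hxy' : r • y = K.incl x := hxy
    rw [← hxy', norm_smul, Real.norm_of_nonneg hr.le, zero_add]
    calc r * ‖y‖ ≤ ε / M * M := by
          gcongr
          exact hKM y hy
      _ = ε := by field_simp

noncomputable instance : NormedAddCommGroup K.NormedSpan := NormedAddCommGroup.ofCore K.normCore

noncomputable instance : NormedSpace ℂ K.NormedSpan := NormedSpace.ofCore K.normCore

end BanachDisk

/-! The core is (a) ⇒ (b), where a neighbourhood of the origin already suffices. There `f` takes
values in a closed disk `A` of the collection. For `y` near a point `x`, the entire function `l ↦ f
(l • y)` maps a disc of radius `ρ` into `A` and is bounded on the disc of radius 2. The Cauchy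
estimates, in `A` by Hahn-Banach and in norm, show that its Taylor sums at 1 lie in `(2/ρ)^N • A`
and miss `f y` by `O(2⁻ᴺ)`. Since `N!` dominates every geometric sequence, a single disk `K = ⋂
closure (N! A + 2⁻ᴺ B)`, with `B` the unit ball of `F`, absorbs `f` locally at every point. `K` is a
uniform limit of sets of the collection, so it belongs to it because the ideal is closed:
approximating operators are lifted to `ℓ¹`. Local boundedness in `F_K` then gives holomorphy into
`F_K`, by Cauchy estimates and polarization (`holomorphic_of_locally_mem_smul`).

For (b) ⇒ (c), surjectivity of the ideal puts the inclusion of `F_K` in it. For (c) ⇒ (a), `g` is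
locally bounded. -/

/-! ### Operators on `ℓ¹` and the sets attached to the ideal. -/

/-- The operator from `ℓ¹(A)` that sends the unit vectors to a given bounded family. -/
theorem exists_clm_lp_one {α : Type u} {Z : Type v} [NormedAddCommGroup Z] [NormedSpace ℂ Z]
    [CompleteSpace Z] (z : α → Z) {M : ℝ} (hM : 0 ≤ M) (hz : ∀ a, ‖z a‖ ≤ M) :
    ∃ L : lp (fun _ : α => ℂ) 1 →L[ℂ] Z, (∀ x, HasSum (fun a => x a • z a) (L x)) ∧ ‖L‖ ≤ M := by
  have hn (x : lp (fun _ : α => ℂ) 1) : HasSum (fun a => ‖x a‖) ‖x‖ := by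
    simpa using lp.hasSum_norm (by simp) x
  have hb (x : lp (fun _ : α => ℂ) 1) (a : α) : ‖x a • z a‖ ≤ M * ‖x a‖ := by
    rw [norm_smul, mul_comm]
    gcongr
    exact hz a
  have hs (x : lp (fun _ : α => ℂ) 1) : Summable fun a => x a • z a :=
    Summable.of_norm_bounded ((hn x).summable.mul_left M) (hb x)
  let l : lp (fun _ : α => ℂ) 1 →ₗ[ℂ] Z :=
    { toFun := fun x => ∑' a, x a • z a
      map_add' := fun x y => by
        rw [← (hs x).tsum_add (hs y)]
        simp [add_smul]
      map_smul' := fun c x => by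
        rw [RingHom.id_apply, ← (hs x).tsum_const_smul c]
        simp [mul_smul] }
  refine ⟨l.mkContinuous M fun x => ?_, fun x => (hs x).hasSum, l.mkContinuous_norm_le hM _⟩
  exact tsum_of_norm_bounded ((hn x).mul_left M) (hb x)

theorem lp_one_single_apply_eq {α : Type u} [DecidableEq α] {Z : Type v} [NormedAddCommGroup Z]
    [NormedSpace ℂ Z] {z : α → Z} {L : lp (fun _ : α => ℂ) 1 →L[ℂ] Z}
    (hL : ∀ x, HasSum (fun a => x a • z a) (L x)) (a : α) : L (lp.single 1 a 1) = z a := by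
  refine (hL _).unique ?_
  convert hasSum_single a fun b hb => ?_ using 1
  · simp
  · rw [lp.single_apply_ne _ _ _ hb, zero_smul]

namespace OperatorIdeal

variable {U : OperatorIdeal.{u}} {F : Type u} [NormedAddCommGroup F] [NormedSpace ℂ F]
  [CompleteSpace F]

theorem comp_clm_mem {E G : Type u} [NormedAddCommGroup E] [NormedSpace ℂ E] [CompleteSpace E]
    [NormedAddCommGroup G] [NormedSpace ℂ G] [CompleteSpace G] {S : E →L[ℂ] F}
    (hS : S ∈ U.component E F) (T : G →L[ℂ] E) : S.comp T ∈ U.component G F := by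
  simpa using U.comp_mem (ContinuousLinearMap.id ℂ F) S T hS

theorem smul_mem_boundedSets {A : Set F} (hA : A ∈ U.BoundedSets F) (c : ℂ) :
    c • A ∈ U.BoundedSets F := by
  obtain ⟨Z, _, _, _, T, hT, hAT⟩ := hA
  refine ⟨Z, _, _, _, c • T, Submodule.smul_mem _ c hT, ?_⟩
  rintro _ ⟨a, ha, rfl⟩
  obtain ⟨z, hz, rfl⟩ := hAT ha
  exact ⟨z, hz, rfl⟩

/-- For a closed ideal, a set that is approximable within every `ε` by sets of the collection
belongs to the collection. -/
theorem mem_boundedSets_of_forall_approx (hU : U.IsClosedIdeal) {A : Set F}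
    (h : ∀ ε > 0, ∃ D ∈ U.BoundedSets F, ∀ a ∈ A, ∃ d ∈ D, ‖a - d‖ ≤ ε) :
    A ∈ U.BoundedSets F := by
  classical
  have hA : ∃ M, 0 ≤ M ∧ ∀ a : A, ‖(a : F)‖ ≤ M := by
    obtain ⟨D, ⟨Z, _, _, _, T, hT, hDT⟩, hD⟩ := h 1 one_pos
    refine ⟨1 + ‖T‖, by positivity, fun a => ?_⟩
    obtain ⟨d, hd, had⟩ := hD a a.2
    obtain ⟨z, hz, rfl⟩ := hDT hd
    have h1 : ‖T z‖ ≤ ‖T‖ :=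
      (T.le_opNorm z).trans (mul_le_of_le_one_right (norm_nonneg _) (by simpa using hz))
    have h2 := norm_le_norm_sub_add (a : F) (T z)
    linarith
  obtain ⟨M, hM, hAM⟩ := hA
  -- On `ℓ¹(A)` the norm of an operator is controlled by its values on unit vectors, so
  -- approximating the points of `A` uniformly approximates `L` in norm.
  obtain ⟨L, hL, -⟩ := exists_clm_lp_one (fun a : A => (a : F)) hM hAM
  refine ⟨lp (fun _ : A => ℂ) 1, inferInstance, inferInstance, inferInstance, L, ?_, ?_⟩
  · refine (hU _ _).closure_subset (Metric.mem_closure_iff.2 fun ε hε => ?_)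
    obtain ⟨D, ⟨Z, _, _, _, T, hT, hDT⟩, hD⟩ := h (ε / 2) (by positivity)
    have hz : ∀ a : A, ∃ z : Z, ‖z‖ ≤ 1 ∧ ‖(a : F) - T z‖ ≤ ε / 2 := by
      intro a
      obtain ⟨d, hd, had⟩ := hD a a.2
      obtain ⟨z, hz, rfl⟩ := hDT hd
      exact ⟨z, by simpa using hz, had⟩
    choose z hz hz' using hz
    obtain ⟨L', hL', -⟩ := exists_clm_lp_one z zero_le_one hz
    obtain ⟨L₂, hL₂, hn⟩ := exists_clm_lp_one (fun a : A => (a : F) - T (z a)) (by positivity) hz'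
    refine ⟨T.comp L', comp_clm_mem hT L', ?_⟩
    have : L - T.comp L' = L₂ := by
      ext1 x
      refine HasSum.unique ?_ (hL₂ x)
      have := (hL x).sub ((hL' x).mapL T)
      simpa [smul_sub] using this
    rw [dist_eq_norm, this]
    linarith
  · intro a ha
    exact ⟨lp.single 1 ⟨a, ha⟩ 1, by simp [lp.norm_single], lp_one_single_apply_eq hL _⟩

end OperatorIdeal

/-! ### The Banach space `F_K`. -/

namespace BanachDisk

variable {F : Type u} [NormedAddCommGroup F] [NormedSpace ℂ F] (K : BanachDisk F)

theorem norm_le_of_incl_mem {x : K.NormedSpan} {r : ℝ} (hr : 0 ≤ r) (h : K.incl x ∈ r • K.carrier) :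
    ‖x‖ ≤ r :=
  gauge_le_of_mem hr h

/-- The infimum in the Minkowski functional is attained because `K` is closed: `t • r⁻¹ • x` lies in
`K` for `t < 1`, and `t` tends to 1. -/
theorem incl_mem_of_norm_le {x : K.NormedSpan} {r : ℝ} (h : ‖x‖ ≤ r) :
    K.incl x ∈ r • K.carrier := by
  have hr : 0 ≤ r := (norm_nonneg x).trans h
  rcases hr.eq_or_lt with rfl | hr
  · have hx : x = 0 := by simpa using h
    exact ⟨0, K.zero_mem, by simp [hx]⟩
  · have hs : StarConvex ℝ 0 K.carrier := K.convex.starConvex K.zero_mem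
    rw [mem_smul_set_iff_inv_smul_mem₀ hr.ne']
    have hle : ∀ t ∈ Ioo (0 : ℝ) 1, t • (r⁻¹ • K.incl x) ∈ K.carrier := by
      intro t ht
      obtain ⟨s, hs0, hs1, y, hy, hxy⟩ := K.exists_lt_mem_smul x (a := r / t)
        (h.trans_lt (by rw [lt_div_iff₀ ht.1]; nlinarith [ht.2]))
      have hxy' : s • y = K.incl x := hxy
      rw [← hxy', smul_smul, smul_smul]
      refine hs.smul_mem hy (by have := ht.1; positivity) ?_
      rw [lt_div_iff₀ ht.1] at hs1
      rw [mul_comm t, mul_assoc, inv_mul_le_iff₀ hr]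
      linarith
    have ht : Filter.Tendsto (fun t : ℝ => t • (r⁻¹ • K.incl x)) (𝓝[<] 1)
        (𝓝 ((1 : ℝ) • (r⁻¹ • K.incl x))) :=
      ((continuous_id.smul continuous_const).tendsto 1).mono_left nhdsWithin_le_nhds
    rw [one_smul] at ht
    refine K.isClosed.mem_of_tendsto ht ?_
    filter_upwards [Ioo_mem_nhdsLT (zero_lt_one' ℝ)] with t ht using hle t ht

theorem exists_incl_eq {y : F} {r : ℝ} (hr : 0 ≤ r) (h : y ∈ r • K.carrier) :
    ∃ x : K.NormedSpan, K.incl x = y ∧ ‖x‖ ≤ r := by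
  obtain ⟨k, hk, rfl⟩ := h
  have hm : r • k ∈ Submodule.span ℂ K.carrier := by
    have := Submodule.smul_mem _ (r : ℂ) (Submodule.subset_span (R := ℂ) hk)
    rwa [Complex.coe_smul] at this
  let x : K.NormedSpan := (⟨r • k, hm⟩ : Submodule.span ℂ K.carrier)
  exact ⟨x, rfl, K.norm_le_of_incl_mem hr ⟨k, hk, rfl⟩⟩

theorem exists_norm_incl_le : ∃ M, 0 ≤ M ∧ ∀ x : K.NormedSpan, ‖K.incl x‖ ≤ M * ‖x‖ := by
  obtain ⟨M, hM, hKM⟩ := K.isBounded.exists_pos_norm_le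
  refine ⟨M, hM.le, fun x => ?_⟩
  obtain ⟨y, hy, hxy⟩ := K.incl_mem_of_norm_le le_rfl (x := x)
  have hxy' : ‖x‖ • y = K.incl x := hxy
  rw [← hxy', norm_smul, norm_norm, mul_comm]
  gcongr
  exact hKM y hy

/-- The inclusion of `F_K` into `F` as a bounded operator. -/
noncomputable def inclL : K.NormedSpan →L[ℂ] F :=
  K.incl.mkContinuousOfExistsBound ⟨_, K.exists_norm_incl_le.choose_spec.2⟩

@[simp] theorem inclL_apply (x : K.NormedSpan) : K.inclL x = K.incl x := rfl

theorem isClosed_smul (r : ℝ) : IsClosed (r • K.carrier) := by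
  rcases eq_or_ne r 0 with rfl | hr
  · rw [zero_smul_set K.nonempty]
    exact isClosed_singleton
  · exact K.isClosed.smul₀ r

/-- The limit is taken in `F`; as `ε • K` is closed there, the Cauchy condition `w n - w m ∈ ε • K`
survives `m → ∞`. -/
instance [CompleteSpace F] : CompleteSpace K.NormedSpan := by
  refine Metric.complete_of_cauchySeq_tendsto fun w hw => ?_
  obtain ⟨y, hy⟩ := cauchySeq_tendsto_of_complete
    (K.inclL.uniformContinuous.comp_cauchySeq hw)
  have key : ∀ ε > (0 : ℝ), ∃ N, ∀ n ≥ N, K.incl (w n) - y ∈ ε • K.carrier := by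
    intro ε hε
    obtain ⟨N, hN⟩ := Metric.cauchySeq_iff.1 hw ε hε
    refine ⟨N, fun n hn => (K.isClosed_smul ε).mem_of_tendsto (hy.const_sub (K.incl (w n))) ?_⟩
    filter_upwards [Filter.eventually_ge_atTop N] with m hm
    have := K.incl_mem_of_norm_le (x := w n - w m) (r := ε)
      (by rw [← dist_eq_norm]; exact (hN n hn m hm).le)
    simpa using this
  obtain ⟨N, hN⟩ := key 1 one_pos
  obtain ⟨x₀, hx₀, -⟩ := K.exists_incl_eq zero_le_one (hN N le_rfl)
  have hx : K.incl (w N - x₀) = y := by rw [map_sub, hx₀]; abel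
  refine ⟨w N - x₀, Metric.tendsto_atTop.2 fun ε hε => ?_⟩
  obtain ⟨N', hN'⟩ := key (ε / 2) (by positivity)
  refine ⟨N', fun n hn => ?_⟩
  rw [dist_eq_norm]
  have := K.norm_le_of_incl_mem (x := w n - (w N - x₀)) (r := ε / 2) (by positivity)
    (by rw [map_sub, hx]; exact hN' n hn)
  linarith

/-- For a surjective ideal, the inclusion of `F_K` into `F` is in the ideal as soon as `K` belongs to
the collection of sets attached to the ideal. -/
theorem inclL_mem_component [CompleteSpace F] {U : OperatorIdeal.{u}} (hU : U.IsSurjectiveIdeal)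
    (hK : K.carrier ∈ U.BoundedSets F) : K.inclL ∈ U.component K.NormedSpan F := by
  classical
  obtain ⟨Z, _, _, _, T, hT, hKT⟩ := hK
  have hx (a : K.carrier) : ∃ x : K.NormedSpan, K.incl x = a ∧ ‖x‖ ≤ 1 :=
    K.exists_incl_eq zero_le_one (by simp)
  have hz (a : K.carrier) : ∃ z : Z, T z = a ∧ ‖z‖ ≤ 1 := by
    obtain ⟨z, hz, hza⟩ := hKT a.2
    exact ⟨z, hza, by simpa using hz⟩
  choose x hxa hx1 using hx
  choose z hza hz1 using hz
  -- Both operators on `ℓ¹(K)` send the unit vector of `a` to `a` once mapped into `F`. Hence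
  -- `K.inclL ∘ L = T ∘ L'` is in the ideal, and `L` is onto.
  obtain ⟨L, hL, -⟩ := exists_clm_lp_one x zero_le_one hx1
  obtain ⟨L', hL', -⟩ := exists_clm_lp_one z zero_le_one hz1
  refine hU K.NormedSpan F (lp (fun _ : K.carrier => ℂ) 1) K.inclL L (fun y => ?_) ?_
  · obtain ⟨a, ha, hay⟩ := K.incl_mem_of_norm_le le_rfl (x := y)
    refine ⟨(‖y‖ : ℂ) • lp.single 1 ⟨a, ha⟩ 1, K.incl_injective ?_⟩
    rw [map_smul, lp_one_single_apply_eq hL, map_smul, hxa, Complex.coe_smul]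
    exact hay
  · have : K.inclL.comp L = T.comp L' := by
      ext1 y
      refine ((hL y).mapL K.inclL).unique ?_
      simpa [hxa, hza] using (hL' y).mapL T
    rw [this]
    exact OperatorIdeal.comp_clm_mem hT L'

end BanachDisk

/-! ### Polarization. -/

/-- Some index `i` is missed by `r`; flipping the sign `ε i` negates the first product and fixes the
second. -/
theorem sum_sign_mul_prod_comp_eq_zero {ι : Type*} [Fintype ι] [DecidableEq ι] {r : ι → ι}
    (hr : ¬ Function.Bijective r) :
    ∑ ε : ι → ℤˣ, (∏ i, (ε i : ℤ)) * ∏ j, (ε (r j) : ℤ) = 0 := by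
  obtain ⟨i, hi⟩ : ∃ i, ∀ j, r j ≠ i := by
    by_contra! h
    exact hr (Finite.surjective_iff_bijective.1 h)
  refine self_eq_neg.1 ?_
  rw [← Finset.sum_neg_distrib]
  refine Fintype.sum_equiv (Equiv.mulLeft (Pi.mulSingle i (-1))) _ _ fun ε => ?_
  have h1 : ∀ j, (Pi.mulSingle i (-1) : ι → ℤˣ) (r j) = 1 := fun j =>
    Pi.mulSingle_eq_of_ne (hi j) _
  have h2 : ∏ j, ((Pi.mulSingle i (-1) : ι → ℤˣ) j : ℤ) = -1 := by
    rw [Finset.prod_eq_single i]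
    · simp
    · intro j _ hj
      rw [Pi.mulSingle_eq_of_ne hj]
      simp
    · simp
  simp [Finset.prod_mul_distrib, h1, h2]

theorem sum_sign_mul_prod_comp_perm {ι : Type*} [Fintype ι] [DecidableEq ι] (σ : Equiv.Perm ι) :
    ∑ ε : ι → ℤˣ, (∏ i, (ε i : ℤ)) * ∏ j, (ε (σ j) : ℤ) = 2 ^ Fintype.card ι := by
  have (ε : ι → ℤˣ) : (∏ i, (ε i : ℤ)) * ∏ j, (ε (σ j) : ℤ) = 1 := by
    rw [Equiv.prod_comp σ fun i => (ε i : ℤ), ← Finset.prod_mul_distrib]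
    exact Finset.prod_eq_one fun i _ => by rw [← Units.val_mul, Int.units_mul_self]; rfl
  simp [this]

/-- The polarization formula for multilinear maps, with signs. -/
theorem MultilinearMap.sum_sign_smul_map_sum {R M N ι : Type*} [CommRing R] [AddCommGroup M]
    [AddCommGroup N] [Module R M] [Module R N] [Fintype ι] [DecidableEq ι]
    (p : MultilinearMap R (fun _ : ι => M) N) (v : ι → M) :
    ∑ ε : ι → ℤˣ, (∏ i, (ε i : ℤ)) • p (fun _ => ∑ i, (ε i : ℤ) • v i) =
      (2 ^ Fintype.card ι : ℤ) • ∑ σ : Equiv.Perm ι, p (v ∘ σ) := by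
  have h (ε : ι → ℤˣ) : p (fun _ => ∑ i, (ε i : ℤ) • v i) =
      ∑ r : ι → ι, (∏ j, (ε (r j) : ℤ)) • p (v ∘ r) := by
    rw [p.map_sum]
    refine Finset.sum_congr rfl fun r _ => ?_
    have := p.map_smul_univ (fun j => ((ε (r j) : ℤ) : R)) (v ∘ r)
    simp only [Int.cast_smul_eq_zsmul, Function.comp_apply, ← Int.cast_prod] at this
    exact this
  simp only [h, Finset.smul_sum, smul_smul]
  rw [Finset.sum_comm]
  simp only [← Finset.sum_smul]
  symm
  rw [← Finset.sum_subset (Finset.subset_univ {r : ι → ι | Function.Bijective r})]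
  · refine Finset.sum_bij' (fun σ _ => (σ : ι → ι))
      (fun r hr => Equiv.ofBijective r (Finset.mem_filter.1 hr).2) ?_ ?_ ?_ ?_ ?_
    · intro σ _
      simp
    · simp
    · intro σ _
      ext
      rfl
    · intro r _
      rfl
    · intro σ _
      rw [sum_sign_mul_prod_comp_perm]
  · intro r _ hr
    rw [sum_sign_mul_prod_comp_eq_zero fun h => hr (Finset.mem_filter.2 ⟨Finset.mem_univ _, h⟩), zero_smul]

/-! ### Cauchy estimates in a disk and Taylor series along lines. -/

/-- A closed, convex, balanced set contains the suitably scaled Taylor coefficients of an entire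
function that takes its values on a disc in the set. -/
theorem iteratedDeriv_mem_smul_of_forall_mem {F : Type u} [NormedAddCommGroup F] [NormedSpace ℂ F]
    [CompleteSpace F] {A : Set F} (hA : IsClosed A) (hAc : Convex ℝ A) (hAb : Balanced ℂ A)
    {g : ℂ → F} {ρ : ℝ} (hρ : 0 < ρ) (hg : DiffContOnCl ℂ g (Metric.ball 0 ρ))
    (h : ∀ l, ‖l‖ ≤ ρ → g l ∈ A) (m : ℕ) :
    (ρ ^ m / m.factorial : ℝ) • iteratedDeriv m g 0 ∈ A := by
  by_contra hx
  obtain ⟨φ, s, hs, hφ⟩ := RCLike.geometric_hahn_banach_closed_point (𝕜 := ℂ) hAc hA hx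
  have hs0 : 0 < s := by
    have := hs 0 (hAb.zero_mem ⟨_, h 0 (by simpa using hρ.le)⟩)
    simpa using this
  -- Rotating `a` inside the balanced set `A` turns the bound on the real part of `φ` into one on
  -- its modulus; the scalar Cauchy estimate for `φ ∘ g` then contradicts separation.
  have hn : ∀ a ∈ A, ‖φ a‖ ≤ s := by
    intro a ha
    rcases eq_or_ne (φ a) 0 with h0 | h0
    · rw [h0, norm_zero]
      exact hs0.le
    · have h1 := hs _ (hAb.smul_mem (a := (‖φ a‖ : ℂ) / φ a) (by simp [h0]) ha)
      rw [map_smul, smul_eq_mul, div_mul_cancel₀ _ h0] at h1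
      simpa using h1.le
  have hd : DiffContOnCl ℂ (φ ∘ g) (Metric.ball 0 ρ) := φ.differentiable.comp_diffContOnCl hg
  have hcd : ContDiffAt ℂ m g 0 :=
    ((hg.differentiableOn.analyticAt (Metric.ball_mem_nhds _ hρ)).contDiffAt)
  have hφg : iteratedDeriv m (φ ∘ g) 0 = φ (iteratedDeriv m g 0) := by
    rw [iteratedDeriv_eq_iteratedFDeriv, φ.iteratedFDeriv_comp_left hcd le_rfl,
      iteratedDeriv_eq_iteratedFDeriv]
    rfl
  have hc := Complex.norm_iteratedDeriv_le_of_forall_mem_sphere_norm_le m hρ hd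
    (C := s) fun z hz => hn _ (h z (by simpa using (mem_sphere_iff_norm.1 hz).le))
  rw [hφg] at hc
  have h2 : ‖φ ((ρ ^ m / m.factorial : ℝ) • iteratedDeriv m g 0)‖ ≤ s := by
    rw [← Complex.coe_smul, map_smul, norm_smul, Complex.norm_real, Real.norm_of_nonneg (by positivity)]
    calc _ ≤ ρ ^ m / m.factorial * (m.factorial * s / ρ ^ m) := by gcongr
      _ = s := by field_simp
  exact absurd ((hφ.trans_le (RCLike.re_le_norm _)).trans_le h2) (lt_irrefl _)

section EntireMappings

variable {E F : Type*} [NormedAddCommGroup E] [NormedSpace ℂ E] [NormedAddCommGroup F]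
  [NormedSpace ℂ F] {f : E → F}

theorem Holomorphic.differentiable_line (hf : Holomorphic f) (x h : E) :
    Differentiable ℂ fun l : ℂ => f (x + l • h) := by
  have hd : Differentiable ℂ f := fun y => (hf y).differentiableAt
  exact hd.comp (by fun_prop)

theorem Holomorphic.contDiff [CompleteSpace F] (hf : Holomorphic f) {n : WithTop ℕ∞} :
    ContDiff ℂ n f :=
  contDiff_iff_contDiffAt.2 fun x => (hf x).contDiffAt

theorem Holomorphic.iteratedDeriv_line [CompleteSpace F] (hf : Holomorphic f) (x h : E) (n : ℕ) :
    iteratedDeriv n (fun l : ℂ => f (x + l • h)) 0 = iteratedFDeriv ℂ n f x fun _ => h := by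
  have h1 : (fun l : ℂ => f (x + l • h)) =
      (fun y => f (x + y)) ∘ (ContinuousLinearMap.toSpanSingleton ℂ h) := by
    ext l
    simp
  have h2 : ContDiff ℂ n fun y => f (x + y) := hf.contDiff.comp (by fun_prop)
  rw [iteratedDeriv_eq_iteratedFDeriv, h1,
    (ContinuousLinearMap.toSpanSingleton ℂ h).iteratedFDeriv_comp_right h2 _ le_rfl,
    iteratedFDeriv_comp_add_left]
  simp

theorem Holomorphic.hasSum_taylor [CompleteSpace F] (hf : Holomorphic f) (x h : E) :
    HasSum (fun n : ℕ => (n.factorial : ℂ)⁻¹ • iteratedFDeriv ℂ n f x fun _ => h) (f (x + h)) := by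
  have := Complex.hasSum_taylorSeries_of_entire (hf.differentiable_line x h) 0 1
  simpa [hf.iteratedDeriv_line] using this

end EntireMappings

/-! ### Holomorphy into `F_K`. -/

namespace BanachDisk

variable {F : Type u} [NormedAddCommGroup F] [NormedSpace ℂ F] (K : BanachDisk F)
  {E : Type v} [NormedAddCommGroup E] [NormedSpace ℂ E]

/-- A symmetric multilinear map whose diagonal takes the unit ball into a multiple of `K` lifts to a
bounded multilinear map into `F_K`. -/
theorem exists_multilinear_lift {n : ℕ} (D : ContinuousMultilinearMap ℂ (fun _ : Fin n => E) F)
    (hsymm : ∀ v (σ : Equiv.Perm (Fin n)), D (v ∘ σ) = D v) {C : ℝ} (hC : 0 ≤ C)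
    (hD : ∀ h : E, ‖h‖ ≤ 1 → D (fun _ => h) ∈ C • K.carrier) :
    ∃ q : ContinuousMultilinearMap ℂ (fun _ : Fin n => E) K.NormedSpan,
      (∀ v, K.incl (q v) = D v) ∧ ‖q‖ ≤ C * (n ^ n / n.factorial) := by
  have hlift (R : ℝ) (hR : 0 ≤ R) (h : E) (hh : ‖h‖ ≤ R) :
      ∃ w : K.NormedSpan, K.incl w = D (fun _ => h) ∧ ‖w‖ ≤ C * R ^ n := by
    -- `R = 0` occurs below when `n = 0`, where `R ^ n = 1`.
    rcases hR.eq_or_lt with rfl | hR'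
    · obtain ⟨w, hw, hw'⟩ := K.exists_incl_eq hC (hD 0 (by simp))
      have h0 : h = 0 := by simpa using hh
      rcases Nat.eq_zero_or_pos n with rfl | hn
      · exact ⟨w, by rw [hw, h0], by simpa using hw'⟩
      · refine ⟨0, ?_, by simp [hn.ne']⟩
        rw [h0, map_zero, D.map_coord_zero ⟨0, hn⟩ rfl]
    · obtain ⟨w, hw, hw'⟩ := K.exists_incl_eq hC (hD ((R : ℂ)⁻¹ • h) (by
        rw [norm_smul, norm_inv, Complex.norm_real, Real.norm_of_nonneg hR,
          inv_mul_le_iff₀ hR']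
        simpa using hh))
      refine ⟨(R : ℂ) ^ n • w, ?_, ?_⟩
      · have h1 := D.map_smul_univ (fun _ => (R : ℂ)) fun _ => (R : ℂ)⁻¹ • h
        have hRc : (R : ℂ) ≠ 0 := by exact_mod_cast hR'.ne'
        simp only [smul_inv_smul₀ hRc, Finset.prod_const, Finset.card_univ, Fintype.card_fin] at h1
        rw [map_smul, hw, h1]
      · rw [norm_smul, norm_pow, Complex.norm_real, Real.norm_of_nonneg hR, mul_comm]
        gcongr
  have hball (v : Fin n → E) (hv : ∀ i, ‖v i‖ ≤ 1) :
      ∃ w : K.NormedSpan, K.incl w = D v ∧ ‖w‖ ≤ C * (n ^ n / n.factorial) := by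
    -- This bound is the source of the factor `n ^ n`.
    have hsum (ε : Fin n → ℤˣ) : ‖∑ i, (ε i : ℤ) • v i‖ ≤ n := by
      refine (norm_sum_le_of_le _ (n := fun _ => 1) fun i _ => ?_).trans (by simp)
      rcases Int.units_eq_one_or (ε i) with h | h <;> simp [h, hv i]
    choose w hw hw' using fun ε => hlift n (by positivity) _ (hsum ε)
    have hpol := D.toMultilinearMap.sum_sign_smul_map_sum v
    simp only [ContinuousMultilinearMap.coe_coe, hsymm, Finset.sum_const, Finset.card_univ,
      Fintype.card_perm, Fintype.card_fin] at hpol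
    have hwn : ‖∑ ε : Fin n → ℤˣ, (∏ i, (ε i : ℤ)) • w ε‖ ≤ 2 ^ n * (C * n ^ n) := by
      refine (norm_sum_le_of_le _ (n := fun _ => C * (n : ℝ) ^ n) fun ε _ => ?_).trans (by simp)
      have : (∏ i, (ε i : ℤ)) = 1 ∨ (∏ i, (ε i : ℤ)) = -1 := by
        rw [← Units.coe_prod]
        rcases Int.units_eq_one_or (∏ i, ε i) with h | h <;> simp [h]
      rcases this with h | h <;> simp [h, hw' ε]
    have hc : (2 ^ n * n.factorial : ℂ) ≠ 0 := by
      exact_mod_cast (Nat.mul_pos (by positivity) n.factorial_pos).ne'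
    refine ⟨(2 ^ n * n.factorial : ℂ)⁻¹ • ∑ ε : Fin n → ℤˣ, (∏ i, (ε i : ℤ)) • w ε, ?_, ?_⟩
    · simp only [map_smul, map_sum, map_zsmul, hw, hpol]
      rw [inv_smul_eq_iff₀ hc, mul_smul, Nat.cast_smul_eq_nsmul, ← Int.cast_smul_eq_zsmul ℂ]
      push_cast
      rfl
    · rw [norm_smul, norm_inv, norm_mul, norm_pow, RCLike.norm_natCast, RCLike.norm_ofNat]
      have : (0 : ℝ) < n.factorial := by exact_mod_cast n.factorial_pos
      rw [inv_mul_le_iff₀ (by positivity)]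
      calc _ ≤ _ := hwn
        _ = _ := by field_simp
  have hall (v : Fin n → E) :
      ∃ w : K.NormedSpan, K.incl w = D v ∧ ‖w‖ ≤ C * (n ^ n / n.factorial) * ∏ i, ‖v i‖ := by
    by_cases hv : ∃ i, v i = 0
    · obtain ⟨i, hi⟩ := hv
      exact ⟨0, by rw [map_zero, D.map_coord_zero i hi], by simp; positivity⟩
    · push Not at hv
      obtain ⟨w, hw, hw'⟩ := hball (fun i => (‖v i‖ : ℂ)⁻¹ • v i) fun i => by
        rw [norm_smul, norm_inv, Complex.norm_real, norm_norm,
          inv_mul_cancel₀ (norm_ne_zero_iff.2 (hv i))]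
      refine ⟨(∏ i, (‖v i‖ : ℂ)) • w, ?_, ?_⟩
      · rw [map_smul, hw, ← D.map_smul_univ]
        congr 1
        ext i
        exact smul_inv_smul₀ (by exact_mod_cast norm_ne_zero_iff.2 (hv i)) _
      · rw [norm_smul, norm_prod, mul_comm]
        simp only [Complex.norm_real, norm_norm]
        gcongr
  choose q hq hq' using hall
  let Q : MultilinearMap ℂ (fun _ : Fin n => E) K.NormedSpan :=
    { toFun := q
      map_update_add' := fun v i x y => K.incl_injective (by simp [hq])
      map_update_smul' := fun v i c x => K.incl_injective (by simp [hq]) }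
  exact ⟨Q.mkContinuous _ hq', hq, Q.mkContinuous_norm_le (by positivity) _⟩

/-- An entire mapping with values in `F_K` that is locally bounded in `F_K` is holomorphic as a mapping
into `F_K`. -/
theorem holomorphic_of_locally_mem_smul [CompleteSpace F] {f : E → F} (hf : Holomorphic f)
    (hloc : ∀ x, ∃ V ∈ 𝓝 x, ∃ c : ℝ, 0 ≤ c ∧ ∀ y ∈ V, f y ∈ c • K.carrier) (fK : E → K.NormedSpan)
    (hfK : ∀ x, K.incl (fK x) = f x) : Holomorphic fK := by
  intro x
  obtain ⟨V, hV, c, hc, hVc⟩ := hloc x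
  obtain ⟨ρ, hρ, hρV⟩ := Metric.nhds_basis_closedBall.mem_iff.1 hV
  have hcoef (n : ℕ) (h : E) (hh : ‖h‖ ≤ 1) :
      iteratedFDeriv ℂ n f x (fun _ => h) ∈ (c * (n.factorial / ρ ^ n)) • K.carrier := by
    have := iteratedDeriv_mem_smul_of_forall_mem (K.isClosed_smul c) (K.convex.smul c)
      (K.balanced.smul c) hρ (hf.differentiable_line x h).diffContOnCl (fun l hl => hVc _ (hρV ?_)) n
    · rw [hf.iteratedDeriv_line] at this
      obtain ⟨k, hk, hk'⟩ := this
      refine ⟨k, hk, ?_⟩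
      have hk'' : c • k = (ρ ^ n / n.factorial : ℝ) • iteratedFDeriv ℂ n f x (fun _ => h) := hk'
      have h0 : (n.factorial : ℝ) ≠ 0 := by exact_mod_cast n.factorial_ne_zero
      change (c * (n.factorial / ρ ^ n)) • k = _
      rw [mul_comm, mul_smul, hk'', smul_smul]
      convert one_smul ℝ _ using 2
      field_simp
    · rw [mem_closedBall_iff_norm, add_sub_cancel_left, norm_smul]
      calc ‖l‖ * ‖h‖ ≤ ρ * 1 := by gcongr
        _ = ρ := mul_one ρ
  choose q hq hqn using fun n => K.exists_multilinear_lift (iteratedFDeriv ℂ n f x)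
    (fun v σ => hf.contDiff.contDiffAt.iteratedFDeriv_comp_perm v σ)
    (by positivity) (hcoef n)
  let p : FormalMultilinearSeries ℂ E K.NormedSpan := fun n => (n.factorial : ℂ)⁻¹ • q n
  -- The polarization constant `n ^ n / n!` is at most `e ^ n`, so it only shrinks the radius from
  -- `ρ` to `ρ / e`.
  have hpn (n : ℕ) : ‖p n‖ ≤ c * (Real.exp 1 / ρ) ^ n := by
    have h0 : (0 : ℝ) < n.factorial := by exact_mod_cast n.factorial_pos
    have h1 : (n : ℝ) ^ n / n.factorial ≤ Real.exp 1 ^ n := by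
      rw [← Real.exp_nat_mul, mul_one]
      exact Real.pow_div_factorial_le_exp _ (by positivity) n
    calc ‖p n‖ = (n.factorial : ℝ)⁻¹ * ‖q n‖ := by simp [p, norm_smul]
      _ ≤ (n.factorial : ℝ)⁻¹ * (c * (n.factorial / ρ ^ n) * Real.exp 1 ^ n) := by
        gcongr
        exact (hqn n).trans (by gcongr)
      _ = c * (Real.exp 1 / ρ) ^ n := by
        rw [div_pow]
        field_simp
  have hrad : 0 < p.radius := by
    let r : NNReal := ⟨ρ / Real.exp 1, by positivity⟩
    have hr : 0 < r := by
      change (0 : ℝ) < ρ / Real.exp 1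
      positivity
    refine (ENNReal.coe_pos.2 hr).trans_le (p.le_radius_of_bound c fun n => ?_)
    calc ‖p n‖ * (r : ℝ) ^ n ≤ c * (Real.exp 1 / ρ) ^ n * (ρ / Real.exp 1) ^ n := by
          gcongr
          exacts [hpn n, le_rfl]
      _ = c * (Real.exp 1 / ρ * (ρ / Real.exp 1)) ^ n := by rw [mul_pow, mul_assoc]
      _ = c := by
        rw [div_mul_div_cancel₀ hρ.ne', div_self (Real.exp_ne_zero 1)]
        simp
  refine ⟨p, p.radius, le_rfl, hrad, fun {y} hy => ?_⟩
  have hs := p.hasSum hy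
  -- After inclusion into `F` the series is the Taylor series of `f` along the line through `x` in
  -- direction `y`, which converges to `f (x + y)`.
  have heq : p.sum y = fK (x + y) := by
    refine K.incl_injective ((hs.mapL K.inclL).unique ?_)
    rw [hfK]
    simpa [p, hq] using hf.hasSum_taylor x y
  rwa [heq] at hs

end BanachDisk

/-! ### The interpolation disk. -/

theorem Convex.smul_set_mono_of_zero_mem {F : Type*} [AddCommGroup F] [Module ℝ F] {A : Set F}
    (hA : Convex ℝ A) (h0 : (0 : F) ∈ A) {s t : ℝ} (hs : 0 ≤ s) (hst : s ≤ t) : s • A ⊆ t • A := by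
  rintro _ ⟨a, ha, rfl⟩
  rcases (hs.trans hst).eq_or_lt with rfl | ht
  · exact ⟨0, h0, by simp [le_antisymm hst hs]⟩
  · refine ⟨(s / t) • a, (hA.starConvex h0).smul_mem ha (by positivity) ((div_le_one ht).2 hst), ?_⟩
    change t • (s / t) • a = s • a
    rw [smul_smul, mul_div_cancel₀ _ ht.ne']

/-- An entire function of one variable that maps a small disc into a disk `A` and is bounded on the
disc of radius `2` takes at `1` a value that is approximable by geometrically growing multiples of `A`
at a geometric rate. -/
theorem BanachDisk.exists_norm_sub_smul_le {F : Type u} [NormedAddCommGroup F] [NormedSpace ℂ F]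
    [CompleteSpace F] (A : BanachDisk F) {g : ℂ → F} (hg : Differentiable ℂ g) {ρ M : ℝ}
    (hρ : 0 < ρ) (hρ1 : ρ ≤ 1) (hgA : ∀ l, ‖l‖ ≤ ρ → g l ∈ A.carrier)
    (hgM : ∀ l, ‖l‖ ≤ 2 → ‖g l‖ ≤ M) (N : ℕ) :
    ∃ a ∈ A.carrier, ‖g 1 - (2 / ρ) ^ N • a‖ ≤ 2 * M * (1 / 2) ^ N := by
  set c : ℕ → F := fun n => (n.factorial : ℂ)⁻¹ • iteratedDeriv n g 0 with hc
  have hsum : HasSum c (g 1) := by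
    simpa using Complex.hasSum_taylorSeries_of_entire hg 0 1
  have hcA (n : ℕ) : c n ∈ (1 / ρ) ^ n • A.carrier := by
    refine ⟨_, iteratedDeriv_mem_smul_of_forall_mem A.isClosed A.convex A.balanced hρ
      hg.diffContOnCl hgA n, ?_⟩
    change (1 / ρ) ^ n • (ρ ^ n / n.factorial : ℝ) • iteratedDeriv n g 0 = c n
    rw [smul_smul, hc, ← Complex.coe_smul]
    congr 1
    push_cast
    have : (ρ : ℂ) ≠ 0 := by exact_mod_cast hρ.ne'
    rw [div_pow, one_pow]
    field_simp
  have hpart (n : ℕ) : ∑ i ∈ Finset.range n, c i ∈ (2 / ρ) ^ n • A.carrier := by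
    induction n with
    | zero => simpa using A.zero_mem
    | succ n ih =>
      rw [Finset.sum_range_succ]
      have hadd := Set.add_mem_add ih (hcA n)
      rw [← A.convex.add_smul (by positivity) (by positivity)] at hadd
      -- As `ρ ≤ 1`, `(2/ρ)^n + (1/ρ)^n ≤ 2 (2/ρ)^n ≤ (2/ρ)^(n+1)`.
      refine A.convex.smul_set_mono_of_zero_mem A.zero_mem (by positivity) ?_ hadd
      have h1 : (1 / ρ) ^ n ≤ (2 / ρ) ^ n := by gcongr; norm_num
      have h2 : 2 ≤ 2 / ρ := by rw [le_div_iff₀ hρ]; linarith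
      have h3 : 0 ≤ (2 / ρ) ^ n := by positivity
      rw [pow_succ]
      nlinarith
  obtain ⟨a, ha, hsa⟩ := hpart N
  refine ⟨a, ha, ?_⟩
  have hsa' : (2 / ρ) ^ N • a = ∑ i ∈ Finset.range N, c i := hsa
  have hcn (n : ℕ) : ‖c n‖ ≤ M * (1 / 2) ^ n := by
    have h1 := Complex.norm_iteratedDeriv_le_of_forall_mem_sphere_norm_le n two_pos
      (hg.diffContOnCl (s := Metric.ball 0 2)) (C := M) fun z hz => hgM z (by
        simpa using (mem_sphere_iff_norm.1 hz).le)
    have h0 : (0 : ℝ) < n.factorial := by exact_mod_cast n.factorial_pos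
    calc ‖c n‖ = (n.factorial : ℝ)⁻¹ * ‖iteratedDeriv n g 0‖ := by simp [hc, norm_smul]
      _ ≤ (n.factorial : ℝ)⁻¹ * (n.factorial * M / 2 ^ n) := by gcongr
      _ = M * (1 / 2) ^ n := by rw [div_pow, one_pow]; field_simp
  have htail : HasSum (fun n => c (n + N)) (g 1 - (2 / ρ) ^ N • a) := by
    rw [hsa']
    exact (hasSum_nat_add_iff' N).2 hsum
  rw [← htail.tsum_eq]
  refine tsum_of_norm_bounded (g := fun n => M * (1 / 2) ^ N * (1 / 2) ^ n) ?_ fun n => ?_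
  · rw [show 2 * M * (1 / 2) ^ N = M * (1 / 2) ^ N * 2 by ring]
    exact hasSum_geometric_two.mul_left _
  · refine (hcn _).trans_eq ?_
    rw [pow_add]
    ring

namespace BanachDisk

variable {F : Type u} [NormedAddCommGroup F] [NormedSpace ℂ F] (A : BanachDisk F)

/-- An interpolation disk between `A` and the unit ball of `F`: the points that are approximable by
`N! • A` up to `2⁻ᴺ` for all `N`. -/
def interpolation : BanachDisk F where
  carrier := ⋂ N : ℕ, closure ((N.factorial : ℝ) • A.carrier + Metric.closedBall 0 ((1 / 2) ^ N))
  nonempty := ⟨0, mem_iInter.2 fun N => subset_closure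
    (Set.mem_add.2 ⟨0, ⟨0, A.zero_mem, smul_zero _⟩, 0, by simp, add_zero _⟩)⟩
  isClosed := isClosed_iInter fun _ => isClosed_closure
  convex := convex_iInter fun _ => ((A.convex.smul _).add (convex_closedBall _ _)).closure
  balanced := balanced_iInter fun _ =>
    ((A.balanced.smul _).add (balanced_closedBall_zero (𝕜 := ℂ))).closure
  isBounded := (((A.isBounded.smul₀ ((Nat.factorial 0 : ℕ) : ℝ)).add
    Metric.isBounded_closedBall).closure).subset (iInter_subset _ 0)

/-- The bound `R ^ N ≤ e ^ R * N!`, valid for all `N`, lets one disk serve every rate `R`. -/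
theorem mem_smul_interpolation {y : F} {R M : ℝ} (hR : 0 ≤ R) (hM : 0 ≤ M)
    (h : ∀ N : ℕ, ∃ a ∈ A.carrier, ‖y - R ^ N • a‖ ≤ M * (1 / 2) ^ N) :
    y ∈ (Real.exp R + M) • A.interpolation.carrier := by
  have hc : 0 < Real.exp R + M := add_pos_of_pos_of_nonneg (Real.exp_pos R) hM
  rw [mem_smul_set_iff_inv_smul_mem₀ hc.ne']
  refine mem_iInter.2 fun N => subset_closure ?_
  obtain ⟨a, ha, hay⟩ := h N
  refine ⟨(Real.exp R + M)⁻¹ • R ^ N • a, ?_, (Real.exp R + M)⁻¹ • (y - R ^ N • a), ?_, ?_⟩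
  · have h0 : (0 : ℝ) < N.factorial := by exact_mod_cast N.factorial_pos
    rw [smul_smul]
    refine A.convex.smul_set_mono_of_zero_mem A.zero_mem (by positivity) ?_ ⟨a, ha, rfl⟩
    have := Real.pow_div_factorial_le_exp R hR N
    rw [div_le_iff₀ h0] at this
    rw [inv_mul_le_iff₀ hc]
    nlinarith
  · rw [mem_closedBall_zero_iff, norm_smul, norm_inv, Real.norm_of_nonneg hc.le,
      inv_mul_le_iff₀ hc]
    refine hay.trans ?_
    gcongr
    linarith [Real.exp_pos R]
  · simp [← smul_add]

/-- The `N`-th set of the intersection lies within `ε` of `N! • A` once `2⁻ᴺ < ε / 2`, the other `ε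
/ 2` paying for the closure. -/
theorem interpolation_mem_boundedSets [CompleteSpace F] {U : OperatorIdeal.{u}}
    (hU : U.IsClosedIdeal) (hA : A.carrier ∈ U.BoundedSets F) :
    A.interpolation.carrier ∈ U.BoundedSets F := by
  refine OperatorIdeal.mem_boundedSets_of_forall_approx hU fun ε hε => ?_
  obtain ⟨N, hN⟩ := exists_pow_lt_of_lt_one (half_pos hε) (y := (1 / 2 : ℝ)) (by norm_num)
  refine ⟨_, OperatorIdeal.smul_mem_boundedSets hA (N.factorial : ℂ), fun y hy => ?_⟩
  obtain ⟨_, ⟨_, ⟨a, ha, rfl⟩, b, hb, rfl⟩, hyz⟩ :=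
    Metric.mem_closure_iff.1 (mem_iInter.1 hy N) (ε / 2) (half_pos hε)
  refine ⟨_, ⟨a, ha, rfl⟩, ?_⟩
  have hb' := mem_closedBall_zero_iff.1 hb
  simp only [dist_eq_norm, ← Complex.coe_smul, Complex.ofReal_natCast] at hyz ⊢
  calc _ = ‖(y - ((N.factorial : ℂ) • a + b)) + b‖ := by congr 1; abel
    _ ≤ _ := norm_add_le _ _
    _ ≤ ε := by linarith

end BanachDisk

/-- Near every point, an entire mapping that takes a neighbourhood of the origin into `A` takes its
values in a multiple of the interpolation disk of `A`. -/
theorem Holomorphic.exists_mem_smul_interpolation {E : Type v} [NormedAddCommGroup E]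
    [NormedSpace ℂ E] {F : Type u} [NormedAddCommGroup F] [NormedSpace ℂ F] [CompleteSpace F]
    {f : E → F} (hf : Holomorphic f) (A : BanachDisk F) {W : Set E} (hW : W ∈ 𝓝 0)
    (hfW : ∀ y ∈ W, f y ∈ A.carrier) (x : E) :
    ∃ V ∈ 𝓝 x, ∃ c : ℝ, 0 ≤ c ∧ ∀ y ∈ V, f y ∈ c • A.interpolation.carrier := by
  have hfc : Continuous f := continuous_iff_continuousAt.2 fun y => (hf y).continuousAt
  obtain ⟨r, hr, hrW⟩ := Metric.nhds_basis_closedBall.mem_iff.1 hW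
  obtain ⟨M, hM⟩ := (isCompact_closedBall (0 : ℂ) 2).exists_bound_of_continuousOn
    (f := fun l : ℂ => f (l • x)) (by fun_prop)
  have hM0 : 0 ≤ M := (norm_nonneg _).trans (hM 0 (by simp))
  -- An entire mapping may be unbounded on bounded sets; compactness of the disc gives a bound
  -- uniform in `y` near `x`.
  have hev : ∀ᶠ y in 𝓝 x, ∀ l ∈ Metric.closedBall (0 : ℂ) 2, ‖f (l • y)‖ < M + 1 := by
    refine (isCompact_closedBall (0 : ℂ) 2).eventually_forall_of_forall_eventually fun l hl => ?_
    have hcont : Continuous fun z : E × ℂ => ‖f (z.2 • z.1)‖ := by fun_prop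
    exact hcont.continuousAt.eventually_lt continuousAt_const ((hM l hl).trans_lt (lt_add_one M))
  have hev' : ∀ᶠ y in 𝓝 x, ‖y‖ < ‖x‖ + 1 :=
    continuous_norm.continuousAt.eventually_lt continuousAt_const (lt_add_one ‖x‖)
  have hx1 : 0 < ‖x‖ + 1 := by positivity
  -- With this radius, `‖l • y‖ ≤ r` whenever `‖y‖ < ‖x‖ + 1`.
  have hρ : 0 < min 1 (r / (‖x‖ + 1)) := by positivity
  refine ⟨_, hev.and hev', Real.exp (2 / min 1 (r / (‖x‖ + 1))) + 2 * (M + 1), by positivity, ?_⟩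
  rintro y ⟨hy, hy'⟩
  refine A.mem_smul_interpolation (by positivity) (by positivity) fun N => ?_
  have := A.exists_norm_sub_smul_le (g := fun l : ℂ => f (l • y)) (M := M + 1)
    (by simpa using hf.differentiable_line 0 y) hρ (min_le_left _ _) (fun l hl => hfW _ (hrW ?_))
    (fun l hl => (hy l (by simpa using hl)).le) N
  · simpa using this
  · rw [mem_closedBall_zero_iff, norm_smul]
    calc ‖l‖ * ‖y‖ ≤ r / (‖x‖ + 1) * (‖x‖ + 1) := by
          gcongr
          exact hl.trans (min_le_right _ _)
      _ = r := div_mul_cancel₀ r hx1.ne'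

/-- The closure of the image of the unit ball under a bounded operator. -/
def BanachDisk.closureImageBall {Z : Type v} [NormedAddCommGroup Z] [NormedSpace ℂ Z] {F : Type u}
    [NormedAddCommGroup F] [NormedSpace ℂ F] (T : Z →L[ℂ] F) : BanachDisk F where
  carrier := closure (T '' Metric.closedBall 0 1)
  nonempty := ⟨T 0, subset_closure (mem_image_of_mem _ (by simp))⟩
  isClosed := isClosed_closure
  convex := ((convex_closedBall (0 : Z) 1).is_linear_image
    (T.restrictScalars ℝ).toLinearMap.isLinear).closure
  balanced := Balanced.closure fun c hc => by
    rw [← image_smul_set]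
    exact image_mono (balanced_closedBall_zero c hc)
  isBounded := (T.lipschitz.isBounded_image Metric.isBounded_closedBall).closure

theorem BanachDisk.closureImageBall_mem_boundedSets {U : OperatorIdeal.{u}} (hU : U.IsClosedIdeal)
    {Z F : Type u} [NormedAddCommGroup Z] [NormedSpace ℂ Z] [CompleteSpace Z]
    [NormedAddCommGroup F] [NormedSpace ℂ F] [CompleteSpace F] {T : Z →L[ℂ] F}
    (hT : T ∈ U.component Z F) : (closureImageBall T).carrier ∈ U.BoundedSets F := by
  refine OperatorIdeal.mem_boundedSets_of_forall_approx hU fun ε hε =>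
    ⟨_, ⟨Z, _, _, _, T, hT, Subset.rfl⟩, fun a ha => ?_⟩
  obtain ⟨d, hd, had⟩ := Metric.mem_closure_iff.1 ha ε hε
  exact ⟨d, hd, by rw [← dist_eq_norm]; exact had.le⟩

/-! ### The equivalence. -/

theorem mainTheorem1 (U : OperatorIdeal.{u}) (hU_closed : U.IsClosedIdeal)
    (hU_surj : U.IsSurjectiveIdeal)
    {E : Type u} [NormedAddCommGroup E] [NormedSpace ℂ E] [CompleteSpace E]
    {F : Type u} [NormedAddCommGroup F] [NormedSpace ℂ F] [CompleteSpace F]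
    (f : E → F) (hf : Holomorphic f) :
    List.TFAE [
      U.LocallyBounded f,
      ∃ K : BanachDisk F, K.carrier ∈ U.BoundedSets F ∧
        ∃ fK : E → K.NormedSpan, Holomorphic fK ∧ ∀ x, K.incl (fK x) = f x,
      ∃ (G : Type u) (_ : NormedAddCommGroup G) (_ : NormedSpace ℂ G) (_ : CompleteSpace G)
        (g : E → G) (T : G →L[ℂ] F),
        Holomorphic g ∧ T ∈ U.component G F ∧ f = T ∘ g] := by
  tfae_have 1 → 2 := by
    intro h
    obtain ⟨W, hW, Z, _, _, _, T, hT, hWT⟩ := h 0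
    let A := BanachDisk.closureImageBall T
    have hfA := hf.exists_mem_smul_interpolation A hW fun y hy =>
      subset_closure (hWT (mem_image_of_mem f hy))
    have hlift (x : E) : ∃ w : A.interpolation.NormedSpan, A.interpolation.incl w = f x := by
      obtain ⟨V, hV, c, hc, hVc⟩ := hfA x
      obtain ⟨w, hw, -⟩ := A.interpolation.exists_incl_eq hc (hVc x (mem_of_mem_nhds hV))
      exact ⟨w, hw⟩
    choose fK hfK using hlift
    exact ⟨A.interpolation, A.interpolation_mem_boundedSets hU_closed
      (BanachDisk.closureImageBall_mem_boundedSets hU_closed hT), fK,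
      A.interpolation.holomorphic_of_locally_mem_smul hf hfA fK hfK, hfK⟩
  tfae_have 2 → 3 := by
    rintro ⟨K, hK, fK, hfK, h⟩
    exact ⟨K.NormedSpan, inferInstance, inferInstance, inferInstance, fK, K.inclL, hfK,
      K.inclL_mem_component hU_surj hK, funext fun x => (h x).symm⟩
  tfae_have 3 → 1 := by
    rintro ⟨G, _, _, _, g, T, hg, hT, rfl⟩ x
    refine ⟨g ⁻¹' Metric.closedBall 0 (‖g x‖ + 1), (hg x).continuousAt.preimage_mem_nhds
      (Filter.mem_of_superset (Metric.ball_mem_nhds _ one_pos) fun z hz => ?_), G, _, _, _,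
      ((‖g x‖ + 1 : ℝ) : ℂ) • T, Submodule.smul_mem _ _ hT, ?_⟩
    · have h1 := norm_le_norm_sub_add z (g x)
      have h2 := mem_ball_iff_norm.1 hz
      rw [mem_closedBall_zero_iff]
      linarith
    · rintro _ ⟨y, hy, rfl⟩
      have hp : 0 < ‖g x‖ + 1 := by positivity
      have hpc : ((‖g x‖ + 1 : ℝ) : ℂ) ≠ 0 := by exact_mod_cast hp.ne'
      refine ⟨((‖g x‖ + 1 : ℝ) : ℂ)⁻¹ • g y, ?_, ?_⟩
      · rw [mem_closedBall_zero_iff, norm_smul, norm_inv, Complex.norm_real,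
          Real.norm_of_nonneg hp.le, inv_mul_le_iff₀ hp]
        simpa using hy
      · rw [map_smul, smul_apply, inv_smul_smul₀ hpc]
        rfl
  tfae_finish
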